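/- For $\alpha\in\mathbb{R}$ let $D_\alpha$ be the space of all analytic functions $g(z)=\sum_{k\ge 0}a_kz^k$ on the open unit disk $\mathbb{D}$ with $\|g\|_\alpha^2=\sum_{k\ge 0}(k+1)^\alpha|a_k|^2<\infty$. For $m\ge 0$ let $\mathrm{Pol}_m$ be the space of complex polynomials of degree at most $m$, and for $f\cdot\mathrm{Pol}_m\subseteq D_\alpha$ write $\mathrm{dist}_{D_\alpha}(1,f\cdot\mathrm{Pol}_m)=\inf\{\|1-pf\|_\alpha : p\in\mathrm{Pol}_m\}$. For $\alpha\le 1$ and $s\ge 0$ put $\varphi_\alpha(s)=s^{1-\alpha}$ if $\alpha<1$ and $\varphi_\alpha(s)=\log^+ s$ if $\alpha=1$. **Theorem.** Let $\alpha\le 1$ and let $f$ be analytic on a neighbourhood of the closed unit disk with no zeros in $\mathbb{D}$. Then $f\cdot\mathrm{Pol}_m\subseteq D_\alpha$ for every $m\ge 0$, and there is a constant $C=C(\alpha,f)>0$ such that $$\mathrm{dist}^2_{D_\alpha}(1,f\cdot\mathrm{Pol}_m)\le \frac{C}{\varphi_\alpha(m+1)}$$ for all sufficiently large $m$. Moreover,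 this estimate is sharp: if in addition $f$ has at least one zero on the unit circle $\mathbb{T}$, then there is a constant $\tilde C=\tilde C(\alpha,f)>0$ such that $$\frac{\tilde C}{\varphi_\alpha(m+1)}\le \mathrm{dist}^2_{D_\alpha}(1,f\cdot\mathrm{Pol}_m)$$ for every $m\ge 0$ with $\varphi_\alpha(m+1)>0$ (that is, for every $m\ge 0$ if $\alpha<1$, and for every $m\ge 1$ if $\alpha=1$). -/

import Mathlib

open Filter Metric Polynomial

noncomputable section

namespace DirichletType

/-- The `k`-th Taylor coefficient of `g` at the origin. -/
def taylorCoeff (g : ℂ → ℂ) (k : ℕ) : ℂ :=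
  iteratedDeriv k g 0 / (k.factorial : ℂ)

/-- The Dirichlet-type space `D_α`: functions that are analytic in the open unit disk and satisfy
`∑ (k+1)^α |a_k|² < ∞`, where the `a_k` are the Taylor coefficients at the origin. (A function on
the disk is represented by a function on `ℂ`; only its values in the disk matter.) -/
def space (α : ℝ) : Set (ℂ → ℂ) :=
  {g | AnalyticOnNhd ℂ g (ball 0 1) ∧
    Summable fun k : ℕ => ((k : ℝ) + 1) ^ α * ‖taylorCoeff g k‖ ^ 2}

/-- The norm `‖g‖_α = (∑ (k+1)^α |a_k|²)^{1/2}` of `D_α` (meaningful for `g ∈ space α`). -/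
def dnorm (α : ℝ) (g : ℂ → ℂ) : ℝ :=
  Real.sqrt (∑' k : ℕ, ((k : ℝ) + 1) ^ α * ‖taylorCoeff g k‖ ^ 2)

/-- `dist_{D_α}(x, A) = inf {‖x - a‖_α : a ∈ A}` (meaningful for `x ∈ space α`,
`A ⊆ space α`, `A` nonempty). -/
def dist (α : ℝ) (x : ℂ → ℂ) (A : Set (ℂ → ℂ)) : ℝ :=
  sInf ((fun a => dnorm α (x - a)) '' A)

/-- `f · Pol_m`: the products of `f` with the polynomials of degree at most `m`. -/
def mulPol (f : ℂ → ℂ) (m : ℕ) : Set (ℂ → ℂ) :=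
  {g | ∃ p : ℂ[X], p.natDegree ≤ m ∧ g = fun z => f z * p.eval z}

/-- The auxiliary function `φ_α` on `[0, ∞)`, for `α ≤ 1`:
`s^{1-α}` if `α < 1` and `log⁺ s` if `α = 1`. -/
def phi (α s : ℝ) : ℝ :=
  if α < 1 then s ^ (1 - α) else Real.posLog s

end DirichletType

end

/-!
Let `v k = (k+1)^{-α}` and `S n = ∑_{k<n} v k`; for `α ≤ 1` the sums `S n` and `φ_α(n)` are
comparable (`exists_phi_le_mul_weightSum`, `exists_weightSum_le_mul_phi`) and `S` is doubling
(`exists_weightSum_mul_le`), so both estimates can be proved with `S` in place of `φ_α`.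

Since `f` is analytic on the closed disk, `f = g h` with `g = ∏ (z - ζ_i)` a polynomial whose zeros
are those of `f` on the circle, and `h` zero-free on the closed disk
(`exists_unit_circle_factorization`). The Taylor coefficients of `h` and `1/h` decay
geometrically, so multiplication by either is bounded on `D_α` (`sqNorm_mul_le`, Young's
inequality).

*Upper bound.* The polynomial `e = S(n)⁻¹ ∑_{k<n} v k (z/ζ)^k` equals `1` at `ζ` and has squared
norm `1 / S n`. Writing `∏ (1 - e_{ζ_i}) = 1 - E`, the polynomial `1 - E` is divisible by `g`. The
space `D_α` is not an algebra, but the coefficientwise bound `|a_k| ≤ A v k / S n` for polynomials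
of degree `O(n)` is stable under products, because `∑_{i+j=k} v i v j ≤ C v k S(k+1)`
(`sum_antidiagonal_weight_le`). Hence `E` satisfies such a bound and `‖E‖² ≤ C / S n`. If `T` is
the `n`-th Taylor polynomial of `1/h` and `t = 1/h - T`, then `p = T (1 - E) / g` has degree `O(n)`
and `1 - p f = E + h t (1 - E)`, where the multiplier norm of `t` is smaller than any power of `1 / n`
(`GeomDecay.exists_mulNorm_tail_le`).

*Lower bound.* If `f ζ = 0` with `|ζ| = 1`, then `(1/h) (1 - p f) = 1/h - p g`. A partial sum of
length greater than `deg (p g)`, evaluated at `ζ`, is a partial sum of `1/h` at `ζ`, and these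
converge to `1/h(ζ) ≠ 0`. By Cauchy-Schwarz the partial sum of length `N` is at most
`(S N)^{1/2} ‖(1/h) (1 - p f)‖ ≤ C (S N)^{1/2} ‖1 - p f‖`, and `N` can be taken comparable to
`m + 1` (`exists_le_sqNorm_one_sub`).
-/

noncomputable section

namespace DirichletType

open scoped Topology

/-! ### Weights `(k+1)^s`, their partial sums, and `φ_α` -/

/-- The weight `(k+1)^s`. -/
def weight (s : ℝ) (k : ℕ) : ℝ := ((k : ℝ) + 1) ^ s

/-- The partial sum `∑_{k<n} (k+1)^{-α}`, a discrete version of `φ_α(n)`. -/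
def weightSum (α : ℝ) (n : ℕ) : ℝ := ∑ k ∈ Finset.range n, weight (-α) k

lemma weight_pos (s : ℝ) (k : ℕ) : 0 < weight s k := by unfold weight; positivity

lemma one_le_weight {s : ℝ} (hs : 0 ≤ s) (k : ℕ) : 1 ≤ weight s k :=
  Real.one_le_rpow (by linarith [k.cast_nonneg (α := ℝ)]) hs

lemma weight_mul_weight_neg (s : ℝ) (k : ℕ) : weight s k * weight (-s) k = 1 := by
  unfold weight
  rw [← Real.rpow_add (by positivity)]; simp

lemma weight_le_weight_abs (s : ℝ) (k : ℕ) : weight s k ≤ weight |s| k :=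
  Real.rpow_le_rpow_of_exponent_le (by linarith [k.cast_nonneg (α := ℝ)]) (le_abs_self s)

lemma weight_add_le (s : ℝ) (i j : ℕ) : weight s (i + j) ≤ weight |s| i * weight s j := by
  unfold weight
  have hi : (0 : ℝ) ≤ i := i.cast_nonneg
  have hj : (0 : ℝ) ≤ j := j.cast_nonneg
  push_cast
  rcases le_total 0 s with hs | hs
  · rw [abs_of_nonneg hs, ← Real.mul_rpow (by positivity) (by positivity)]
    exact Real.rpow_le_rpow (by positivity) (by nlinarith) hs
  · calc ((i : ℝ) + j + 1) ^ s ≤ ((j : ℝ) + 1) ^ s :=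
          Real.rpow_le_rpow_of_nonpos (by positivity) (by linarith) hs
      _ ≤ _ := le_mul_of_one_le_left (by positivity)
          (Real.one_le_rpow (by linarith) (abs_nonneg s))

lemma rpow_le_two_rpow_abs_mul {x y : ℝ} (hx : 0 < x) (hy : 0 < y) (hxy : x ≤ 2 * y)
    (hyx : y ≤ 2 * x) (s : ℝ) : x ^ s ≤ 2 ^ |s| * y ^ s := by
  rcases le_total 0 s with hs | hs
  · rw [abs_of_nonneg hs, ← Real.mul_rpow (by positivity) hy.le]
    exact Real.rpow_le_rpow hx.le hxy hs
  · have h : (2 * x) ^ s ≤ y ^ s := Real.rpow_le_rpow_of_nonpos hy hyx hs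
    rw [Real.mul_rpow (by positivity) hx.le] at h
    calc x ^ s = 2 ^ |s| * (2 ^ s * x ^ s) := by
          rw [← mul_assoc, ← Real.rpow_add (by norm_num), abs_of_nonpos hs]; simp
      _ ≤ _ := by gcongr

lemma weight_le_of_le_two_mul {s : ℝ} {i j : ℕ} (hij : i ≤ 2 * j + 1) (hji : j ≤ 2 * i + 1) :
    weight s i ≤ 2 ^ |s| * weight s j := by
  have h1 : (i : ℝ) ≤ 2 * j + 1 := by exact_mod_cast hij
  have h2 : (j : ℝ) ≤ 2 * i + 1 := by exact_mod_cast hji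
  exact rpow_le_two_rpow_abs_mul (by positivity) (by positivity) (by linarith) (by linarith) s

lemma weightSum_mono (α : ℝ) : Monotone (weightSum α) := fun _ _ h =>
  Finset.sum_le_sum_of_subset_of_nonneg (Finset.range_mono h) fun k _ _ => (weight_pos _ k).le

lemma weightSum_nonneg (α : ℝ) (n : ℕ) : 0 ≤ weightSum α n :=
  Finset.sum_nonneg fun k _ => (weight_pos _ k).le

lemma one_le_weightSum (α : ℝ) {n : ℕ} (hn : 1 ≤ n) : 1 ≤ weightSum α n := by
  calc (1 : ℝ) = weightSum α 1 := by simp [weightSum, weight]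
    _ ≤ _ := weightSum_mono α hn

lemma weightSum_pos (α : ℝ) {n : ℕ} (hn : 1 ≤ n) : 0 < weightSum α n :=
  one_pos.trans_le (one_le_weightSum α hn)

lemma weightSum_two_mul_le (α : ℝ) (n : ℕ) :
    weightSum α (2 * n) ≤ 2 * 2 ^ |α| * weightSum α n := by
  induction n with
  | zero => simp [weightSum]
  | succ n ih =>
    rw [show 2 * (n + 1) = 2 * n + 1 + 1 by ring]
    have h1 : weight (-α) (2 * n) ≤ 2 ^ |α| * weight (-α) n := by
      rw [← abs_neg α]; exact weight_le_of_le_two_mul (by omega) (by omega)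
    have h2 : weight (-α) (2 * n + 1) ≤ 2 ^ |α| * weight (-α) n := by
      rw [← abs_neg α]; exact weight_le_of_le_two_mul (by omega) (by omega)
    unfold weightSum at ih ⊢
    rw [Finset.sum_range_succ, Finset.sum_range_succ, Finset.sum_range_succ]
    linarith

lemma exists_weightSum_mul_le (α : ℝ) (K : ℕ) :
    ∃ C : ℝ, 0 < C ∧ ∀ n, weightSum α (K * n) ≤ C * weightSum α n := by
  have key : ∀ j n, weightSum α (2 ^ j * n) ≤ (2 * 2 ^ |α|) ^ j * weightSum α n := by
    intro j n
    induction j with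
    | zero => simp
    | succ j ih =>
      rw [pow_succ', mul_assoc, pow_succ', mul_assoc]
      exact (weightSum_two_mul_le α _).trans (by gcongr)
  exact ⟨(2 * 2 ^ |α|) ^ K, by positivity, fun n =>
    (weightSum_mono α (Nat.mul_le_mul_right n K.lt_two_pow_self.le)).trans (key K n)⟩

/-- The sequence `(k+1)^{-α}` convolved with itself is, up to a constant, `(k+1)^{-α}` times its
own partial sum: in `i + j = k` one of the indices is at least `k/2`. -/
lemma sum_antidiagonal_weight_le (α : ℝ) (k : ℕ) :
    ∑ x ∈ Finset.HasAntidiagonal.antidiagonal k, weight (-α) x.1 * weight (-α) x.2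
      ≤ 2 * 2 ^ |α| * weight (-α) k * weightSum α (k + 1) := by
  have hs : ∑ x ∈ Finset.HasAntidiagonal.antidiagonal k, weight (-α) x.1 = weightSum α (k + 1) := by
    rw [Finset.Nat.sum_antidiagonal_eq_sum_range_succ_mk, weightSum]
  have hs' : ∑ x ∈ Finset.HasAntidiagonal.antidiagonal k, weight (-α) x.2
      = weightSum α (k + 1) := by
    rw [← hs, ← Finset.Nat.sum_antidiagonal_swap]; rfl
  have hterm : ∀ x ∈ Finset.HasAntidiagonal.antidiagonal k, weight (-α) x.1 * weight (-α) x.2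
      ≤ 2 ^ |α| * weight (-α) k * (weight (-α) x.1 + weight (-α) x.2) := by
    intro x hx
    have hx' := Finset.HasAntidiagonal.mem_antidiagonal.1 hx
    have p1 := weight_pos (-α) x.1
    have p2 := weight_pos (-α) x.2
    have pk := weight_pos (-α) k
    rw [← abs_neg α]
    rcases le_total x.1 x.2 with h | h
    · have := weight_le_of_le_two_mul (s := -α) (i := x.2) (j := k) (by omega) (by omega)
      calc _ ≤ weight (-α) x.1 * (2 ^ |-α| * weight (-α) k) := by gcongr
        _ ≤ (weight (-α) x.1 + weight (-α) x.2) * (2 ^ |-α| * weight (-α) k) := by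
            gcongr; linarith
        _ = _ := by ring
    · have := weight_le_of_le_two_mul (s := -α) (i := x.1) (j := k) (by omega) (by omega)
      calc _ ≤ (2 ^ |-α| * weight (-α) k) * weight (-α) x.2 := by gcongr
        _ ≤ (2 ^ |-α| * weight (-α) k) * (weight (-α) x.1 + weight (-α) x.2) := by
            gcongr; linarith
  refine (Finset.sum_le_sum hterm).trans_eq ?_
  rw [← Finset.mul_sum, Finset.sum_add_distrib, hs, hs']
  ring

lemma weightSum_one (n : ℕ) : weightSum 1 n = (harmonic n : ℝ) := by
  simp [weightSum, weight, harmonic, Real.rpow_neg_one]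

lemma exists_phi_le_mul_weightSum (α : ℝ) (hα : α ≤ 1) :
    ∃ C : ℝ, 0 < C ∧ ∀ m : ℕ, phi α ((m : ℝ) + 1) ≤ C * weightSum α (m + 1) := by
  rcases hα.lt_or_eq with hα | rfl
  · refine ⟨2 * 2 ^ |α|, by positivity, fun m => ?_⟩
    -- every weight with index at least `m / 2` is comparable to the last one
    have h : ∑ k ∈ Finset.Ico (m / 2) (m + 1), weight (-α) k ≤ weightSum α (m + 1) := by
      rw [weightSum]
      refine Finset.sum_le_sum_of_subset_of_nonneg (fun x hx => ?_)
        fun k _ _ => (weight_pos _ k).le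
      simp only [Finset.mem_Ico, Finset.mem_range] at hx ⊢; omega
    have h2 : ((m : ℝ) + 1) / 2 * weight (-α) m
        ≤ 2 ^ |α| * ∑ k ∈ Finset.Ico (m / 2) (m + 1), weight (-α) k := by
      rw [Finset.mul_sum]
      calc ((m : ℝ) + 1) / 2 * weight (-α) m
          ≤ ∑ k ∈ Finset.Ico (m / 2) (m + 1), weight (-α) m := by
            rw [Finset.sum_const, nsmul_eq_mul, Nat.card_Ico]
            refine mul_le_mul_of_nonneg_right ?_ (weight_pos _ _).le
            rw [div_le_iff₀ two_pos]
            have : m + 1 ≤ (m + 1 - m / 2) * 2 := by omega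
            exact_mod_cast this
        _ ≤ _ := Finset.sum_le_sum fun k hk => by
            have := Finset.mem_Ico.1 hk
            rw [← abs_neg α]
            exact weight_le_of_le_two_mul (by omega) (by omega)
    have h3 : phi α ((m : ℝ) + 1) = ((m : ℝ) + 1) * weight (-α) m := by
      rw [phi, if_pos hα, weight, sub_eq_add_neg, Real.rpow_add (by positivity), Real.rpow_one]
    have : (0 : ℝ) < 2 ^ |α| := by positivity
    rw [h3]
    nlinarith
  · refine ⟨1, one_pos, fun m => ?_⟩
    have h := log_add_one_le_harmonic (m + 1)
    rw [phi, if_neg (lt_irrefl _), weightSum_one, one_mul,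
      Real.posLog_eq_log (by rw [abs_of_nonneg (by positivity)]; linarith [m.cast_nonneg (α := ℝ)])]
    refine le_trans (Real.log_le_log (by positivity) ?_) h
    push_cast; linarith

lemma exists_weightSum_le_mul_phi (α : ℝ) (hα : α ≤ 1) :
    ∃ C : ℝ, 0 < C ∧ ∀ m : ℕ, 0 < phi α ((m : ℝ) + 1) →
      weightSum α (m + 1) ≤ C * phi α ((m : ℝ) + 1) := by
  rcases hα.lt_or_eq with hα | rfl
  · set β := min 1 (1 - α) with hβ
    have hβ0 : 0 < β := lt_min one_pos (by linarith)
    refine ⟨β⁻¹, by positivity, fun m _ => ?_⟩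
    rw [phi, if_pos hα, le_inv_mul_iff₀ hβ0]
    rcases le_total α 0 with h0 | h0
    · have hβ1 : β ≤ 1 := min_le_left _ _
      have : weightSum α (m + 1) ≤ ((m : ℝ) + 1) ^ (1 - α) := by
        calc weightSum α (m + 1) ≤ ∑ _k ∈ Finset.range (m + 1), ((m : ℝ) + 1) ^ (-α) := by
              refine Finset.sum_le_sum fun k hk => ?_
              have : (k : ℝ) ≤ m := by
                exact_mod_cast Nat.lt_succ_iff.1 (Finset.mem_range.1 hk)
              exact Real.rpow_le_rpow (by positivity) (by linarith) (by linarith)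
          _ = _ := by
              rw [Finset.sum_const, Finset.card_range, nsmul_eq_mul, sub_eq_add_neg,
                Real.rpow_add (by positivity), Real.rpow_one]
              push_cast; ring
      nlinarith [weightSum_nonneg α (m + 1)]
    · have hβe : β = 1 - α := min_eq_right (by linarith)
      rw [hβe]
      -- the weights are dominated by the increments of `n ↦ n ^ (1 - α)`
      have key : ∀ n : ℕ, (1 - α) * weightSum α n ≤ (n : ℝ) ^ (1 - α) := by
        intro n
        induction n with
        | zero => simp [weightSum]; positivity
        | succ n ih =>
          have hx : (0 : ℝ) < n + 1 := by positivity
          have hb := rpow_one_add_le_one_add_mul_self (s := -((n : ℝ) + 1)⁻¹)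
            (by have := inv_le_one_of_one_le₀ (show (1 : ℝ) ≤ n + 1 by
                  linarith [n.cast_nonneg (α := ℝ)])
                linarith) (p := 1 - α) (by linarith) (by linarith)
          have he : (n : ℝ) = (n + 1) * (1 + -((n : ℝ) + 1)⁻¹) := by field_simp; ring
          have h1 : (n : ℝ) ^ (1 - α) ≤ ((n : ℝ) + 1) ^ (1 - α)
              * (1 + (1 - α) * -((n : ℝ) + 1)⁻¹) := by
            have hnn : (0 : ℝ) ≤ 1 + -((n : ℝ) + 1)⁻¹ := by
              by_contra hneg
              have : (n : ℝ) < 0 := by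
                rw [he]; exact mul_neg_of_pos_of_neg hx (not_le.1 hneg)
              linarith [n.cast_nonneg (α := ℝ)]
            calc (n : ℝ) ^ (1 - α)
                = ((n : ℝ) + 1) ^ (1 - α) * (1 + -((n : ℝ) + 1)⁻¹) ^ (1 - α) := by
                  rw [← Real.mul_rpow hx.le hnn, ← he]
              _ ≤ _ := by gcongr
          have h2 : ((n : ℝ) + 1) ^ (1 - α) * ((n : ℝ) + 1)⁻¹ = weight (-α) n := by
            rw [weight, ← Real.rpow_neg_one, ← Real.rpow_add hx]; congr 1; ring
          rw [weightSum] at ih ⊢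
          rw [Finset.sum_range_succ, mul_add]
          push_cast
          have h3 : ((n : ℝ) + 1) ^ (1 - α) * (1 + (1 - α) * -((n : ℝ) + 1)⁻¹)
            = ((n : ℝ) + 1) ^ (1 - α) - (1 - α) * weight (-α) n := by rw [← h2]; ring
          linarith
      exact_mod_cast key (m + 1)
  · have hl2 : 0 < Real.log 2 := Real.log_pos (by norm_num)
    refine ⟨(Real.log 2)⁻¹ + 1, by positivity, fun m hm => ?_⟩
    have hm0 : (0 : ℝ) ≤ m := m.cast_nonneg
    rw [phi, if_neg (lt_irrefl _), Real.posLog_eq_log (by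
      rw [abs_of_nonneg (by positivity)]; linarith)] at hm ⊢
    have hm1 : 1 ≤ m := by
      rcases Nat.eq_zero_or_pos m with rfl | h
      · simp at hm
      · exact h
    have h := harmonic_le_one_add_log (m + 1)
    have h2 : Real.log 2 ≤ Real.log ((m : ℝ) + 1) := by
      refine Real.log_le_log (by norm_num) ?_
      have : (1 : ℝ) ≤ m := by exact_mod_cast hm1
      linarith
    rw [weightSum_one]
    push_cast at h
    have h3 : 1 ≤ (Real.log 2)⁻¹ * Real.log ((m : ℝ) + 1) := by
      rwa [le_inv_mul_iff₀ hl2, mul_one]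
    linarith

/-! ### Power series: norms and Young's inequality -/

/-- Membership in `D_α`, on the level of Taylor series. -/
def MemSeq (α : ℝ) (F : PowerSeries ℂ) : Prop :=
  Summable fun k => weight α k * ‖F.coeff k‖ ^ 2

/-- The squared norm of `D_α`, on the level of Taylor series. -/
def sqNorm (α : ℝ) (F : PowerSeries ℂ) : ℝ := ∑' k, weight α k * ‖F.coeff k‖ ^ 2

/-- The weighted `ℓ¹` norm `∑ (k+1)^{|α|} |a_k|`; it dominates the norm of multiplication by
`∑ a_k z^k` on `D_α`. -/
def mulNorm (α : ℝ) (F : PowerSeries ℂ) : ℝ := ∑' k, weight |α| k * ‖F.coeff k‖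

/-- The coefficients decay geometrically: the series converges beyond the closed unit disk. -/
def GeomDecay (F : PowerSeries ℂ) : Prop :=
  ∃ B r : ℝ, 0 < r ∧ r < 1 ∧ ∀ k, ‖F.coeff k‖ ≤ B * r ^ k

lemma sqNorm_nonneg (α : ℝ) (F : PowerSeries ℂ) : 0 ≤ sqNorm α F :=
  tsum_nonneg fun k => mul_nonneg (weight_pos _ k).le (by positivity)

lemma mulNorm_nonneg (α : ℝ) (F : PowerSeries ℂ) : 0 ≤ mulNorm α F :=
  tsum_nonneg fun k => mul_nonneg (weight_pos _ k).le (by positivity)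

lemma memSeq_polynomial (α : ℝ) (P : ℂ[X]) : MemSeq α (P : PowerSeries ℂ) := by
  refine summable_of_ne_finset_zero (s := Finset.range (P.natDegree + 1)) fun k hk => ?_
  rw [Polynomial.coeff_coe, Polynomial.coeff_eq_zero_of_natDegree_lt
    (by rw [Finset.mem_range] at hk; omega)]
  simp

lemma weight_mul_norm_add_le (α : ℝ) (F G : PowerSeries ℂ) (k : ℕ) :
    weight α k * ‖(F + G).coeff k‖ ^ 2
      ≤ 2 * (weight α k * ‖F.coeff k‖ ^ 2) + 2 * (weight α k * ‖G.coeff k‖ ^ 2) := by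
  have h : ‖(F + G).coeff k‖ ≤ ‖F.coeff k‖ + ‖G.coeff k‖ := by
    rw [map_add]; exact norm_add_le _ _
  have h2 : ‖(F + G).coeff k‖ ^ 2 ≤ 2 * ‖F.coeff k‖ ^ 2 + 2 * ‖G.coeff k‖ ^ 2 := by
    nlinarith [norm_nonneg ((F + G).coeff k), sq_nonneg (‖F.coeff k‖ - ‖G.coeff k‖)]
  calc _ ≤ weight α k * (2 * ‖F.coeff k‖ ^ 2 + 2 * ‖G.coeff k‖ ^ 2) :=
        mul_le_mul_of_nonneg_left h2 (weight_pos _ _).le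
    _ = _ := by ring

lemma MemSeq.add {α : ℝ} {F G : PowerSeries ℂ} (hF : MemSeq α F) (hG : MemSeq α G) :
    MemSeq α (F + G) :=
  Summable.of_nonneg_of_le (fun k => mul_nonneg (weight_pos _ k).le (by positivity))
    (weight_mul_norm_add_le α F G) ((hF.mul_left 2).add (hG.mul_left 2))

lemma sqNorm_add_le {α : ℝ} {F G : PowerSeries ℂ} (hF : MemSeq α F) (hG : MemSeq α G) :
    sqNorm α (F + G) ≤ 2 * sqNorm α F + 2 * sqNorm α G := by
  unfold sqNorm
  rw [← tsum_mul_left, ← tsum_mul_left, ← (hF.mul_left 2).tsum_add (hG.mul_left 2)]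
  exact (hF.add hG).tsum_le_tsum (weight_mul_norm_add_le α F G)
    ((hF.mul_left 2).add (hG.mul_left 2))

/-- The termwise form of Young's inequality, from Cauchy-Schwarz with the weights `|F_i|`. -/
lemma weight_mul_norm_coeff_mul_le (α : ℝ) {F : PowerSeries ℂ} (G : PowerSeries ℂ)
    (hF : Summable fun k => weight |α| k * ‖F.coeff k‖) (k : ℕ) :
    weight α k * ‖(F * G).coeff k‖ ^ 2 ≤ mulNorm α F *
      ∑ x ∈ Finset.HasAntidiagonal.antidiagonal k,
        (weight |α| x.1 * ‖F.coeff x.1‖) * (weight α x.2 * ‖G.coeff x.2‖ ^ 2) := by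
  set A := Finset.HasAntidiagonal.antidiagonal k with hA
  have h1 : ‖(F * G).coeff k‖ ≤ ∑ x ∈ A, ‖F.coeff x.1‖ * ‖G.coeff x.2‖ := by
    rw [PowerSeries.coeff_mul]
    exact (norm_sum_le _ _).trans_eq (by simp only [norm_mul]; rfl)
  have h2 : (∑ x ∈ A, ‖F.coeff x.1‖ * ‖G.coeff x.2‖) ^ 2 ≤
      (∑ x ∈ A, ‖F.coeff x.1‖) * ∑ x ∈ A, ‖F.coeff x.1‖ * ‖G.coeff x.2‖ ^ 2 :=
    Finset.sum_sq_le_sum_mul_sum_of_sq_le_mul _ (fun _ _ => norm_nonneg _)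
      (fun _ _ => by positivity) (fun _ _ => (by ring : _ = _).le)
  have h3 : ∑ x ∈ A, ‖F.coeff x.1‖ ≤ mulNorm α F := by
    have : ∑ x ∈ A, ‖F.coeff x.1‖ = ∑ i ∈ Finset.range (k + 1), ‖F.coeff i‖ := by
      rw [hA, Finset.Nat.sum_antidiagonal_eq_sum_range_succ_mk]
    rw [this]
    calc _ ≤ ∑ i ∈ Finset.range (k + 1), weight |α| i * ‖F.coeff i‖ :=
          Finset.sum_le_sum fun i _ =>
            le_mul_of_one_le_left (norm_nonneg _) (one_le_weight (abs_nonneg _) i)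
      _ ≤ _ := hF.sum_le_tsum _ fun i _ => mul_nonneg (weight_pos _ i).le (norm_nonneg _)
  have h4 : weight α k * ∑ x ∈ A, ‖F.coeff x.1‖ * ‖G.coeff x.2‖ ^ 2 ≤
      ∑ x ∈ A, (weight |α| x.1 * ‖F.coeff x.1‖) * (weight α x.2 * ‖G.coeff x.2‖ ^ 2) := by
    rw [Finset.mul_sum]
    refine Finset.sum_le_sum fun x hx => ?_
    have hk := weight_add_le α x.1 x.2
    rw [Finset.HasAntidiagonal.mem_antidiagonal.1 hx] at hk
    calc _ ≤ (weight |α| x.1 * weight α x.2) * (‖F.coeff x.1‖ * ‖G.coeff x.2‖ ^ 2) := by gcongr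
      _ = _ := by ring
  have hS : 0 ≤ ∑ x ∈ A, ‖F.coeff x.1‖ * ‖G.coeff x.2‖ ^ 2 :=
    Finset.sum_nonneg fun _ _ => by positivity
  have hw := weight_pos α k
  calc _ ≤ weight α k * ((∑ x ∈ A, ‖F.coeff x.1‖) *
        ∑ x ∈ A, ‖F.coeff x.1‖ * ‖G.coeff x.2‖ ^ 2) := by
        gcongr
        exact (pow_le_pow_left₀ (norm_nonneg _) h1 2).trans h2
    _ ≤ weight α k * (mulNorm α F * ∑ x ∈ A, ‖F.coeff x.1‖ * ‖G.coeff x.2‖ ^ 2) := by gcongr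
    _ = mulNorm α F * (weight α k * ∑ x ∈ A, ‖F.coeff x.1‖ * ‖G.coeff x.2‖ ^ 2) := by ring
    _ ≤ _ := by gcongr; exact mulNorm_nonneg _ _

lemma summable_antidiagonal_mul {a b : ℕ → ℝ} (ha : Summable a) (hb : Summable b) :
    Summable fun k => ∑ x ∈ Finset.HasAntidiagonal.antidiagonal k, a x.1 * b x.2 :=
  (summable_norm_sum_mul_antidiagonal_of_summable_norm ha.norm hb.norm).of_norm

lemma MemSeq.mul {α : ℝ} {F G : PowerSeries ℂ}
    (hF : Summable fun k => weight |α| k * ‖F.coeff k‖) (hG : MemSeq α G) : MemSeq α (F * G) :=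
  Summable.of_nonneg_of_le (fun k => mul_nonneg (weight_pos _ k).le (by positivity))
    (weight_mul_norm_coeff_mul_le α G hF) ((summable_antidiagonal_mul hF hG).mul_left _)

/-- Young's inequality in `D_α`. -/
lemma sqNorm_mul_le {α : ℝ} {F G : PowerSeries ℂ}
    (hF : Summable fun k => weight |α| k * ‖F.coeff k‖) (hG : MemSeq α G) :
    sqNorm α (F * G) ≤ mulNorm α F ^ 2 * sqNorm α G := by
  have h := (MemSeq.mul hF hG).tsum_le_tsum (weight_mul_norm_coeff_mul_le α G hF)
    ((summable_antidiagonal_mul hF hG).mul_left _)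
  refine h.trans_eq ?_
  rw [tsum_mul_left, sqNorm, sq, mul_assoc]
  have hprod := tsum_mul_tsum_eq_tsum_sum_antidiagonal_of_summable_norm hF.norm hG.norm
  rw [← hprod]
  rfl

lemma summable_weight_mul_pow (s : ℝ) {r : ℝ} (hr0 : 0 < r) (hr1 : r < 1) :
    Summable fun k => weight s k * r ^ k := by
  have h1 : Summable fun k : ℕ => (((k + 1 : ℕ) : ℝ)) ^ ⌈|s|⌉₊ * r ^ (k + 1) :=
    (summable_nat_add_iff (f := fun k : ℕ => (k : ℝ) ^ ⌈|s|⌉₊ * r ^ k) 1).2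
      (summable_pow_mul_geometric_of_norm_lt_one ⌈|s|⌉₊ (by rwa [Real.norm_of_nonneg hr0.le]))
  refine Summable.of_nonneg_of_le (fun k => mul_nonneg (weight_pos _ k).le (by positivity))
    (fun k => ?_) (h1.mul_left r⁻¹)
  have h2 : weight s k ≤ (((k + 1 : ℕ) : ℝ)) ^ ⌈|s|⌉₊ := by
    rw [← Real.rpow_natCast, weight]
    push_cast
    exact Real.rpow_le_rpow_of_exponent_le (by linarith [k.cast_nonneg (α := ℝ)])
      ((le_abs_self s).trans (Nat.le_ceil _))
  calc _ ≤ (((k + 1 : ℕ) : ℝ)) ^ ⌈|s|⌉₊ * r ^ k := by gcongr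
    _ = _ := by rw [pow_succ]; field_simp

namespace GeomDecay

variable {F : PowerSeries ℂ}

lemma summable (hF : GeomDecay F) (s : ℝ) : Summable fun k => weight s k * ‖F.coeff k‖ := by
  obtain ⟨B, r, hr0, hr1, h⟩ := hF
  refine Summable.of_nonneg_of_le (fun k => mul_nonneg (weight_pos _ k).le (norm_nonneg _))
    (fun k => ?_) ((summable_weight_mul_pow s hr0 hr1).mul_left B)
  calc _ ≤ weight s k * (B * r ^ k) := mul_le_mul_of_nonneg_left (h k) (weight_pos _ _).le
    _ = _ := by ring

lemma memSeq (hF : GeomDecay F) (α : ℝ) : MemSeq α F := by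
  have h := MemSeq.mul (α := α) (hF.summable |α|) (memSeq_polynomial α 1)
  simpa using h

end GeomDecay

lemma weightSum_le_weight (α : ℝ) (n : ℕ) : weightSum α n ≤ weight (1 + |α|) n := by
  calc weightSum α n ≤ ∑ _k ∈ Finset.range n, weight |α| n := by
        refine Finset.sum_le_sum fun k hk => (weight_le_weight_abs _ _).trans ?_
        rw [abs_neg]
        have : (k : ℝ) ≤ n := by exact_mod_cast (Finset.mem_range.1 hk).le
        exact Real.rpow_le_rpow (by positivity) (by linarith) (abs_nonneg _)
    _ = (n : ℝ) * weight |α| n := by simp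
    _ ≤ ((n : ℝ) + 1) * weight |α| n := by have := weight_pos |α| n; nlinarith
    _ = _ := by rw [weight, weight, Real.rpow_add (by positivity), Real.rpow_one]

/-- The tails of a geometrically decaying series are negligible: their multiplier norm is smaller
than any negative power of the truncation index. -/
lemma GeomDecay.exists_mulNorm_tail_le {F : PowerSeries ℂ} (hF : GeomDecay F) (α : ℝ) :
    ∃ C : ℝ, ∀ n : ℕ, 1 ≤ n →
      mulNorm α (F - (PowerSeries.trunc n F : PowerSeries ℂ)) ^ 2 ≤ C / weightSum α n ∧
      Summable fun k =>
        weight |α| k * ‖(F - (PowerSeries.trunc n F : PowerSeries ℂ)).coeff k‖ := by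
  set s := 1 + |α| with hs
  have hsum := hF.summable (|α| + s)
  set U := ∑' k, weight (|α| + s) k * ‖F.coeff k‖ with hU
  refine ⟨U ^ 2, fun n hn => ?_⟩
  have hterm : ∀ k, weight |α| k * ‖(F - (PowerSeries.trunc n F : PowerSeries ℂ)).coeff k‖
      ≤ weight (-s) n * (weight (|α| + s) k * ‖F.coeff k‖) := by
    intro k
    rw [map_sub, Polynomial.coeff_coe, PowerSeries.coeff_trunc]
    split_ifs with hk
    · have := weight_pos (-s) n
      have := weight_pos (|α| + s) k
      simp only [sub_self, norm_zero, mul_zero]; positivity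
    · rw [sub_zero, ← mul_assoc]
      refine mul_le_mul_of_nonneg_right ?_ (norm_nonneg _)
      have h1 : weight s n ≤ weight s k := by
        have : (n : ℝ) ≤ k := by exact_mod_cast not_lt.1 hk
        exact Real.rpow_le_rpow (by positivity) (by linarith) (by positivity)
      have h2 : weight (|α| + s) k = weight |α| k * weight s k := by
        rw [weight, Real.rpow_add (by positivity)]; rfl
      have h3 := weight_mul_weight_neg s n
      have p1 := weight_pos |α| k
      have p2 := weight_pos (-s) n
      rw [h2]
      calc weight |α| k = weight (-s) n * (weight |α| k * weight s n) := by
            linear_combination (-weight |α| k) * h3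
        _ ≤ _ := by gcongr
  have hsm : Summable fun k =>
      weight |α| k * ‖(F - (PowerSeries.trunc n F : PowerSeries ℂ)).coeff k‖ :=
    Summable.of_nonneg_of_le (fun k => mul_nonneg (weight_pos _ k).le (norm_nonneg _)) hterm
      (hsum.mul_left _)
  refine ⟨?_, hsm⟩
  have hle : mulNorm α (F - (PowerSeries.trunc n F : PowerSeries ℂ)) ≤ weight (-s) n * U := by
    rw [hU, ← tsum_mul_left]
    exact hsm.tsum_le_tsum hterm (hsum.mul_left _)
  have hS := weightSum_pos α hn
  have hp := weight_pos (-s) n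
  have h1 : weight (-s) n * weightSum α n ≤ 1 := by
    rw [← weight_mul_weight_neg s n, mul_comm]
    gcongr
    exact weightSum_le_weight α n
  have h2 : weight (-s) n ≤ 1 := by
    have := one_le_weightSum α hn
    nlinarith
  rw [le_div_iff₀ hS]
  calc _ ≤ (weight (-s) n * U) ^ 2 * weightSum α n := by
        gcongr; exact mulNorm_nonneg _ _
    _ = U ^ 2 * (weight (-s) n * (weight (-s) n * weightSum α n)) := by ring
    _ ≤ U ^ 2 * (1 * 1) := by gcongr
    _ = _ := by ring

/-! ### Taylor series and zeros on the unit circle -/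

/-- The Taylor series of `g` at the origin. -/
def taylorSeries (g : ℂ → ℂ) : PowerSeries ℂ := PowerSeries.mk (taylorCoeff g)

@[simp] lemma coeff_taylorSeries (g : ℂ → ℂ) (k : ℕ) : (taylorSeries g).coeff k = taylorCoeff g k :=
  PowerSeries.coeff_mk _ _

lemma taylorSeries_congr {f g : ℂ → ℂ} (h : f =ᶠ[𝓝 0] g) : taylorSeries f = taylorSeries g := by
  ext k
  simp [taylorCoeff, h.iteratedDeriv_eq k]

lemma taylorSeries_mul {f g : ℂ → ℂ} (hf : AnalyticAt ℂ f 0) (hg : AnalyticAt ℂ g 0) :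
    taylorSeries (f * g) = taylorSeries f * taylorSeries g := by
  ext k
  rw [PowerSeries.coeff_mul, Finset.Nat.sum_antidiagonal_eq_sum_range_succ_mk]
  simp only [coeff_taylorSeries, taylorCoeff, iteratedDeriv_mul hf.contDiffAt hg.contDiffAt,
    Finset.sum_div, Nat.succ_eq_add_one]
  refine Finset.sum_congr rfl fun i hi => ?_
  rw [Nat.cast_choose _ (Nat.lt_succ_iff.1 (Finset.mem_range.1 hi))]
  field_simp [Nat.factorial_ne_zero]

lemma taylorSeries_add {f g : ℂ → ℂ} (hf : AnalyticAt ℂ f 0) (hg : AnalyticAt ℂ g 0) :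
    taylorSeries (f + g) = taylorSeries f + taylorSeries g := by
  ext k
  simp [taylorCoeff, iteratedDeriv_add hf.contDiffAt hg.contDiffAt, add_div]

lemma taylorSeries_sub {f g : ℂ → ℂ} (hf : AnalyticAt ℂ f 0) (hg : AnalyticAt ℂ g 0) :
    taylorSeries (f - g) = taylorSeries f - taylorSeries g := by
  ext k
  simp [taylorCoeff, iteratedDeriv_sub hf.contDiffAt hg.contDiffAt, sub_div]

lemma analyticAt_eval (P : ℂ[X]) (z : ℂ) : AnalyticAt ℂ (fun z => P.eval z) z :=
  AnalyticOnNhd.eval_polynomial P z trivial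

lemma taylorSeries_eval (P : ℂ[X]) : taylorSeries (fun z => P.eval z) = (P : PowerSeries ℂ) := by
  induction P using Polynomial.induction_on' with
  | add P Q hP hQ =>
    rw [Polynomial.coe_add, ← hP, ← hQ,
      ← taylorSeries_add (analyticAt_eval P 0) (analyticAt_eval Q 0)]
    congr 1
    ext z
    simp
  | monomial n a =>
    ext k
    have h : (fun z : ℂ => (monomial n a).eval z) = fun z => a * z ^ n := by
      ext z; simp
    rw [coeff_taylorSeries, taylorCoeff, h, iteratedDeriv_const_mul_field,
      iteratedDeriv_fun_pow_zero,
      Polynomial.coeff_coe, Polynomial.coeff_monomial]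
    split_ifs with h1 h2 h2
    · subst h1
      field_simp [Nat.factorial_ne_zero]
    · exact absurd h1.symm h2
    · exact absurd h2.symm h1
    · simp

lemma taylorSeries_one : taylorSeries 1 = 1 := by
  have h := taylorSeries_eval 1
  simp only [Polynomial.eval_one, Polynomial.coe_one] at h
  exact h

/-- Analyticity on the closed disk extends to a larger disk. -/
lemma exists_one_lt_analyticOnNhd_closedBall {g : ℂ → ℂ}
    (hg : AnalyticOnNhd ℂ g (closedBall 0 1)) :
    ∃ R : ℝ, 1 < R ∧ AnalyticOnNhd ℂ g (closedBall 0 R) := by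
  obtain ⟨δ, hδ, h⟩ := (isCompact_closedBall (0 : ℂ) 1).exists_cthickening_subset_open
    (isOpen_analyticAt ℂ g) hg
  refine ⟨1 + δ, by linarith, fun z hz => h ?_⟩
  rw [cthickening_closedBall hδ.le zero_le_one]
  rwa [add_comm] at hz

lemma geomDecay_taylorSeries {g : ℂ → ℂ} (hg : AnalyticOnNhd ℂ g (closedBall 0 1)) :
    GeomDecay (taylorSeries g) := by
  obtain ⟨R, hR, hgR⟩ := exists_one_lt_analyticOnNhd_closedBall hg
  have hR0 : 0 < R := by linarith
  obtain ⟨B, hB⟩ := (isCompact_closedBall (0 : ℂ) R).exists_bound_of_continuousOn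
    hgR.continuousOn
  refine ⟨B, R⁻¹, by positivity, inv_lt_one_of_one_lt₀ hR, fun k => ?_⟩
  have h := Complex.norm_iteratedDeriv_le_of_forall_mem_sphere_norm_le k hR0
    (hgR.differentiableOn.diffContOnCl_ball subset_rfl)
    (fun z hz => hB z (sphere_subset_closedBall hz))
  rw [coeff_taylorSeries, taylorCoeff, norm_div, Complex.norm_natCast, div_le_iff₀ (by positivity)]
  refine h.trans_eq ?_
  rw [inv_pow]
  field_simp

lemma hasSum_taylorCoeff {g : ℂ → ℂ} (hg : AnalyticOnNhd ℂ g (closedBall 0 1)) {z : ℂ}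
    (hz : z ∈ closedBall (0 : ℂ) 1) : HasSum (fun k => taylorCoeff g k * z ^ k) (g z) := by
  obtain ⟨R, hR, hgR⟩ := exists_one_lt_analyticOnNhd_closedBall hg
  have h := Complex.hasSum_taylorSeries_on_ball
    (hgR.differentiableOn.mono ball_subset_closedBall) (closedBall_subset_ball hR hz)
  have hterm : (fun k => taylorCoeff g k * z ^ k) =
      fun k => (k.factorial : ℂ)⁻¹ • (z - 0) ^ k • iteratedDeriv k g 0 := by
    funext k
    rw [taylorCoeff, sub_zero, smul_eq_mul, smul_eq_mul]
    ring
  rwa [hterm]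

lemma finite_zeros {f : ℂ → ℂ} (hf : AnalyticOnNhd ℂ f (closedBall 0 1))
    (h0 : f 0 ≠ 0) : {z ∈ closedBall (0 : ℂ) 1 | f z = 0}.Finite := by
  have h := hf.preimage_zero_mem_codiscreteWithin h0 (mem_closedBall_self zero_le_one)
    ((convex_closedBall _ _).isConnected ⟨0, mem_closedBall_self zero_le_one⟩)
  refine ((isCompact_closedBall (0 : ℂ) 1).finite_sdiff_of_mem_codiscreteWithin h).subset ?_
  rintro z ⟨hz, hz0⟩
  exact ⟨hz, fun hne => hne hz0⟩

lemma exists_eq_pow_mul {f : ℂ → ℂ} {U : Set ℂ} (hf : AnalyticOnNhd ℂ f U) {ζ : ℂ} (hζ : ζ ∈ U)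
    (hζ0 : f ζ = 0) (hne : ¬ ∀ᶠ z in 𝓝 ζ, f z = 0) :
    ∃ (n : ℕ) (h : ℂ → ℂ), AnalyticOnNhd ℂ h U ∧ h ζ ≠ 0 ∧ ∀ z, f z = (z - ζ) ^ n * h z := by
  obtain ⟨n, g, hg, hgζ, hfg⟩ := (hf ζ hζ).exists_eventuallyEq_pow_smul_nonzero_iff.2 hne
  have hn : n ≠ 0 := by
    rintro rfl
    have := hfg.self_of_nhds
    simp [hζ0] at this
    exact hgζ this.symm
  -- `n ≠ 0` makes the factorization hold at `ζ` itself, whatever value `h` takes there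
  set h : ℂ → ℂ := Function.update (fun z => f z / (z - ζ) ^ n) ζ (g ζ) with hh
  have hζh : h =ᶠ[𝓝 ζ] g := by
    filter_upwards [hfg] with z hz
    rcases eq_or_ne z ζ with rfl | hzζ
    · simp [hh]
    · rw [hh, Function.update_of_ne hzζ, hz, smul_eq_mul,
        mul_div_cancel_left₀ _ (pow_ne_zero _ (sub_ne_zero.2 hzζ))]
  refine ⟨n, h, fun z hz => ?_, by simpa [hh] using hgζ, fun z => ?_⟩
  · rcases eq_or_ne z ζ with rfl | hzζ
    · exact hg.congr hζh.symm
    · have h1 : AnalyticAt ℂ (fun z => f z / (z - ζ) ^ n) z :=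
        (hf z hz).div ((analyticAt_id.sub analyticAt_const).pow n)
          (pow_ne_zero _ (sub_ne_zero.2 hzζ))
      refine h1.congr ?_
      filter_upwards [isOpen_ne.mem_nhds hzζ] with w hw
      rw [hh, Function.update_of_ne hw]
  · rcases eq_or_ne z ζ with rfl | hzζ
    · simp [hζ0, hn]
    · rw [hh, Function.update_of_ne hzζ,
        mul_div_cancel₀ _ (pow_ne_zero _ (sub_ne_zero.2 hzζ))]

/-- A function analytic on the closed disk with finitely many zeros there is the product of a
polynomial, split over these zeros, and an analytic function without zeros. -/
lemma exists_factorization (Z : Finset ℂ) : ∀ {f : ℂ → ℂ},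
    AnalyticOnNhd ℂ f (closedBall 0 1) → f 0 ≠ 0 → (∀ z ∈ closedBall (0 : ℂ) 1, f z = 0 ↔ z ∈ Z) →
    (∀ z ∈ Z, z ∈ closedBall (0 : ℂ) 1) →
    ∃ (s : Multiset ℂ) (h : ℂ → ℂ), (∀ ζ ∈ s, ζ ∈ Z) ∧ AnalyticOnNhd ℂ h (closedBall 0 1) ∧
      (∀ z ∈ closedBall (0 : ℂ) 1, h z ≠ 0) ∧
      ∀ z, f z = (s.map fun ζ => X - C ζ).prod.eval z * h z := by
  induction Z using Finset.induction_on with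
  | empty =>
    intro f hf _ hZ _
    exact ⟨0, f, by simp, hf, fun z hz h0 => by simpa using (hZ z hz).1 h0, by simp⟩
  | insert ζ Z hζZ ih =>
    intro f hf hf0 hZ hZsub
    have hζ : ζ ∈ closedBall (0 : ℂ) 1 := hZsub ζ (Finset.mem_insert_self _ _)
    have hζ0 : f ζ = 0 := (hZ ζ hζ).2 (Finset.mem_insert_self _ _)
    obtain ⟨n, g, hg, hgζ, hfg⟩ := exists_eq_pow_mul hf hζ hζ0 fun hev =>
      hf0 (hf.eqOn_zero_of_preconnected_of_eventuallyEq_zero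
        (convex_closedBall _ _).isPreconnected hζ hev (mem_closedBall_self zero_le_one))
    obtain ⟨s, h, hs, hh, hh0, hgh⟩ := ih hg (fun h0 => hf0 (by rw [hfg, h0, mul_zero]))
      (fun z hz => by
        constructor
        · intro h0
          have := (hZ z hz).1 (by rw [hfg, h0, mul_zero])
          rcases Finset.mem_insert.1 this with rfl | h
          · exact absurd h0 hgζ
          · exact h
        · intro hzZ
          have h1 := (hZ z hz).2 (Finset.mem_insert_of_mem hzZ)
          rw [hfg] at h1
          refine (mul_eq_zero.1 h1).resolve_left (pow_ne_zero _ (sub_ne_zero.2 ?_))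
          rintro rfl
          exact hζZ hzZ)
      (fun z hz => hZsub z (Finset.mem_insert_of_mem hz))
    refine ⟨Multiset.replicate n ζ + s, h, fun z hz => ?_, hh, hh0, fun z => ?_⟩
    · rcases Multiset.mem_add.1 hz with hz | hz
      · rw [Multiset.eq_of_mem_replicate hz]; exact Finset.mem_insert_self _ _
      · exact Finset.mem_insert_of_mem (hs z hz)
    · rw [hfg, hgh]
      simp [mul_assoc]

/-- Splitting off the zeros on the unit circle. -/
lemma exists_unit_circle_factorization {f : ℂ → ℂ} (hf : AnalyticOnNhd ℂ f (closedBall 0 1))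
    (hzero : ∀ z ∈ ball (0 : ℂ) 1, f z ≠ 0) :
    ∃ (s : Multiset ℂ) (h : ℂ → ℂ), (∀ ζ ∈ s, ‖ζ‖ = 1) ∧ AnalyticOnNhd ℂ h (closedBall 0 1) ∧
      (∀ z ∈ closedBall (0 : ℂ) 1, h z ≠ 0) ∧
      ∀ z, f z = (s.map fun ζ => X - C ζ).prod.eval z * h z := by
  have h0 : f 0 ≠ 0 := hzero 0 (mem_ball_self one_pos)
  have hfin := finite_zeros hf h0
  obtain ⟨s, h, hs, hh⟩ := exists_factorization hfin.toFinset hf h0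
    (fun z hz => by simp only [Set.Finite.mem_toFinset]; exact ⟨fun h => ⟨hz, h⟩, fun h => h.2⟩)
    (fun z hz => ((Set.Finite.mem_toFinset hfin).1 hz).1)
  refine ⟨s, h, fun ζ hζ => ?_, hh⟩
  obtain ⟨h1, h2⟩ := (Set.Finite.mem_toFinset hfin).1 (hs ζ hζ)
  refine le_antisymm (mem_closedBall_zero_iff.1 h1) (not_lt.1 fun hlt => ?_)
  exact hzero ζ (mem_ball_zero_iff.2 hlt) h2

/-! ### Polynomial approximation of inverses -/

/-- The polynomial `S⁻¹ ∑_{k<n} (k+1)^{-α} (z/ζ)^k` with `S = ∑_{k<n} (k+1)^{-α}`: the polynomial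
of degree less than `n` and of minimal `D_α` norm among those with value `1` at the point `ζ` of
the unit circle. -/
def extremalPoly (α : ℝ) (n : ℕ) (ζ : ℂ) : ℂ[X] :=
  ∑ k ∈ Finset.range n, monomial k ((weight (-α) k / weightSum α n : ℝ) * (ζ⁻¹) ^ k)

lemma natDegree_extremalPoly_le (α : ℝ) (n : ℕ) (ζ : ℂ) : (extremalPoly α n ζ).natDegree ≤ n :=
  natDegree_sum_le_of_forall_le _ _ fun _ hk =>
    (natDegree_monomial_le _).trans (Finset.mem_range.1 hk).le

lemma eval_extremalPoly (α : ℝ) {n : ℕ} (hn : 1 ≤ n) {ζ : ℂ} (hζ : ζ ≠ 0) :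
    (extremalPoly α n ζ).eval ζ = 1 := by
  have hS := (weightSum_pos α hn).ne'
  rw [extremalPoly, eval_finsetSum]
  have : ∀ k ∈ Finset.range n, (monomial k
      (((weight (-α) k / weightSum α n : ℝ) : ℂ) * (ζ⁻¹) ^ k)).eval ζ
      = ((weight (-α) k / weightSum α n : ℝ) : ℂ) := by
    intro k _
    rw [eval_monomial, mul_assoc, ← mul_pow, inv_mul_cancel₀ hζ, one_pow, mul_one]
  rw [Finset.sum_congr rfl this, ← Complex.ofReal_sum, ← Finset.sum_div, ← weightSum, div_self hS,
    Complex.ofReal_one]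

lemma norm_coeff_extremalPoly_le (α : ℝ) (n : ℕ) {ζ : ℂ} (hζ : ‖ζ‖ = 1) (k : ℕ) :
    ‖(extremalPoly α n ζ).coeff k‖ ≤ weight (-α) k / weightSum α n := by
  have h0 : 0 ≤ weight (-α) k / weightSum α n :=
    div_nonneg (weight_pos _ _).le (weightSum_nonneg _ _)
  simp only [extremalPoly, finsetSum_coeff, coeff_monomial, Finset.sum_ite_eq', Finset.mem_range]
  split_ifs
  · rw [norm_mul, norm_pow, norm_inv, hζ, Complex.norm_real, Real.norm_of_nonneg h0]
    simp
  · simpa using h0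

/-- Polynomials of degree `O(n)` with coefficients `O((k+1)^{-α} / S(n))` are closed under
multiplication. -/
lemma exists_norm_coeff_mul_le (α : ℝ) (d : ℕ) : ∃ A : ℝ, 0 ≤ A ∧
    ∀ n : ℕ, 1 ≤ n → ∀ (P Q : ℂ[X]) (a b : ℝ), 0 ≤ a → 0 ≤ b → (P * Q).natDegree ≤ d * n →
    (∀ k, ‖P.coeff k‖ ≤ a * (weight (-α) k / weightSum α n)) →
    (∀ k, ‖Q.coeff k‖ ≤ b * (weight (-α) k / weightSum α n)) →
    ∀ k, ‖(P * Q).coeff k‖ ≤ A * a * b * (weight (-α) k / weightSum α n) := by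
  obtain ⟨K, hK, hKS⟩ := exists_weightSum_mul_le α (d + 1)
  refine ⟨2 * 2 ^ |α| * K, by positivity, fun n hn P Q a b ha hb hdeg hP hQ k => ?_⟩
  have hS := weightSum_pos α hn
  have hw := weight_pos (-α) k
  rcases lt_or_ge (d * n) k with hk | hk
  · rw [coeff_eq_zero_of_natDegree_lt (hdeg.trans_lt hk), norm_zero]
    positivity
  · rw [coeff_mul]
    calc _ ≤ ∑ x ∈ Finset.HasAntidiagonal.antidiagonal k,
          (a * b / weightSum α n ^ 2) * (weight (-α) x.1 * weight (-α) x.2) := by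
          refine (norm_sum_le _ _).trans (Finset.sum_le_sum fun x _ => ?_)
          rw [norm_mul]
          have h1 := weight_pos (-α) x.1
          have h2 := weight_pos (-α) x.2
          calc _ ≤ (a * (weight (-α) x.1 / weightSum α n)) *
                (b * (weight (-α) x.2 / weightSum α n)) := by
                gcongr
                · exact hP _
                · exact hQ _
            _ = _ := by field_simp
      _ ≤ (a * b / weightSum α n ^ 2) *
          (2 * 2 ^ |α| * weight (-α) k * (K * weightSum α n)) := by
          rw [← Finset.mul_sum]
          gcongr
          refine (sum_antidiagonal_weight_le α k).trans ?_
          gcongr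
          exact (weightSum_mono α (by nlinarith)).trans (hKS n)
      _ = _ := by field_simp

/-- For points `ζ_i` on the unit circle, there are polynomials `E` of degree `O(n)` such that
`1 - E` is divisible by `∏ (z - ζ_i)` and `E` is small. -/
lemma exists_dvd_one_sub (α : ℝ) (s : Multiset ℂ) (hs : ∀ ζ ∈ s, ‖ζ‖ = 1) :
    ∃ A : ℝ, 0 ≤ A ∧ ∀ n : ℕ, 1 ≤ n → ∃ E : ℂ[X], E.natDegree ≤ s.card * n ∧
      (s.map fun ζ => X - C ζ).prod ∣ 1 - E ∧
      ∀ k, ‖E.coeff k‖ ≤ A * (weight (-α) k / weightSum α n) := by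
  induction s using Multiset.induction_on with
  | empty => exact ⟨0, le_rfl, fun n _ => ⟨0, by simp⟩⟩
  | cons ζ s ih =>
    obtain ⟨A, hA, hE⟩ := ih fun z hz => hs z (Multiset.mem_cons_of_mem hz)
    obtain ⟨B, hB, hmul⟩ := exists_norm_coeff_mul_le α (s.card + 1)
    have hζ : ‖ζ‖ = 1 := hs ζ (Multiset.mem_cons_self _ _)
    have hζ0 : ζ ≠ 0 := by rintro rfl; simp at hζ
    refine ⟨1 + A + B * 1 * A, by positivity, fun n hn => ?_⟩
    obtain ⟨E, hEdeg, hEdvd, hEc⟩ := hE n hn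
    set e := extremalPoly α n ζ with he
    have hedeg := natDegree_extremalPoly_le α n ζ
    have hec : ∀ k, ‖e.coeff k‖ ≤ 1 * (weight (-α) k / weightSum α n) := fun k => by
      rw [one_mul]; exact norm_coeff_extremalPoly_le α n hζ k
    have hdeg : (e * E).natDegree ≤ (s.card + 1) * n :=
      natDegree_mul_le.trans ((add_le_add hedeg hEdeg).trans_eq (by ring))
    have hn' : n ≤ (s.card + 1) * n := Nat.le_mul_of_pos_left _ (Nat.succ_pos _)
    have hE' : s.card * n ≤ (s.card + 1) * n := Nat.mul_le_mul_right _ (Nat.le_succ _)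
    refine ⟨e + E - e * E, ?_, ?_, fun k => ?_⟩
    · rw [Multiset.card_cons]
      exact natDegree_sub_le_of_le
        (natDegree_add_le_of_degree_le (hedeg.trans hn') (hEdeg.trans hE')) hdeg |>.trans
          (by simp)
    · rw [Multiset.map_cons, Multiset.prod_cons,
        show 1 - (e + E - e * E) = (1 - e) * (1 - E) by ring]
      refine mul_dvd_mul (dvd_iff_isRoot.2 ?_) hEdvd
      rw [IsRoot.def, eval_sub, eval_one, eval_extremalPoly α hn hζ0, sub_self]
    · rw [coeff_sub, coeff_add]
      refine (norm_sub_le _ _).trans ((add_le_add_left (norm_add_le _ _) _).trans ?_)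
      have := hmul n hn e E 1 A zero_le_one hA hdeg hec hEc k
      linarith [hec k, hEc k]

lemma exists_sqNorm_le (α A : ℝ) (d : ℕ) : ∃ K : ℝ, 0 ≤ K ∧ ∀ n : ℕ, 1 ≤ n → ∀ E : ℂ[X],
    E.natDegree ≤ d * n → (∀ k, ‖E.coeff k‖ ≤ A * (weight (-α) k / weightSum α n)) →
    sqNorm α (E : PowerSeries ℂ) ≤ K / weightSum α n := by
  obtain ⟨K, hK, hKS⟩ := exists_weightSum_mul_le α (d + 1)
  refine ⟨A ^ 2 * K, by positivity, fun n hn E hdeg hE => ?_⟩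
  have hS := weightSum_pos α hn
  have hsupp : ∀ k ∉ Finset.range ((d + 1) * n),
      weight α k * ‖(E : PowerSeries ℂ).coeff k‖ ^ 2 = 0 := fun k hk => by
    rw [Polynomial.coeff_coe, coeff_eq_zero_of_natDegree_lt
      (by rw [Finset.mem_range] at hk; nlinarith)]
    simp
  rw [sqNorm, tsum_eq_sum hsupp]
  calc _ ≤ ∑ k ∈ Finset.range ((d + 1) * n), A ^ 2 / weightSum α n ^ 2 * weight (-α) k := by
        refine Finset.sum_le_sum fun k _ => ?_
        have hw := weight_pos α k
        have hm := weight_mul_weight_neg α k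
        rw [Polynomial.coeff_coe]
        calc _ ≤ weight α k * (A * (weight (-α) k / weightSum α n)) ^ 2 := by
              gcongr; exact hE k
          _ = A ^ 2 / weightSum α n ^ 2 * weight (-α) k * (weight α k * weight (-α) k) := by
              ring
          _ = _ := by rw [hm, mul_one]
    _ = A ^ 2 / weightSum α n ^ 2 * weightSum α ((d + 1) * n) := by
        rw [← Finset.mul_sum]; rfl
    _ ≤ A ^ 2 / weightSum α n ^ 2 * (K * weightSum α n) := by gcongr; exact hKS n
    _ = _ := by field_simp

/-- The upper bound for Taylor series: if `B` is the inverse of `H` and the `ζ_i` lie on the unit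
circle, then `∏ (z - ζ_i) · H` is nearly inverted by polynomials of degree `O(n)`. -/
lemma exists_sqNorm_one_sub_le (α : ℝ) (s : Multiset ℂ) (hs : ∀ ζ ∈ s, ‖ζ‖ = 1)
    {H B : PowerSeries ℂ} (hH : GeomDecay H) (hB : GeomDecay B) (hHB : H * B = 1) :
    ∃ K : ℝ, 0 ≤ K ∧ ∀ n : ℕ, 1 ≤ n → ∃ p : ℂ[X], p.natDegree ≤ (s.card + 1) * n ∧
      sqNorm α (1 - (((s.map fun ζ => X - C ζ).prod : ℂ[X]) : PowerSeries ℂ) * H * p)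
        ≤ K / weightSum α n := by
  obtain ⟨A, hA, hE⟩ := exists_dvd_one_sub α s hs
  obtain ⟨K, hK, hEK⟩ := exists_sqNorm_le α A s.card
  obtain ⟨T, hT⟩ := hB.exists_mulNorm_tail_le α
  set L := mulNorm α H ^ 2 * |T| * (2 * sqNorm α 1 + 2 * K) with hL
  have hL0 : 0 ≤ L := by
    have := sqNorm_nonneg α 1
    positivity
  refine ⟨2 * K + 2 * L, by positivity, fun n hn => ?_⟩
  obtain ⟨E, hEdeg, ⟨R, hR⟩, hEc⟩ := hE n hn
  obtain ⟨hTn, hTs⟩ := hT n hn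
  have hS := weightSum_pos α hn
  set t := B - (PowerSeries.trunc n B : PowerSeries ℂ) with ht
  refine ⟨R * PowerSeries.trunc n B, ?_, ?_⟩
  · have h1 : R.natDegree ≤ s.card * n := by
      have hg : ((s.map fun ζ => X - C ζ).prod).Monic :=
        monic_multiset_prod_of_monic _ _ fun ζ _ => monic_X_sub_C ζ
      have h2 : (1 - E).natDegree ≤ s.card * n :=
        (natDegree_sub_le _ _).trans (by simpa using hEdeg)
      rw [hR] at h2
      rcases eq_or_ne R 0 with rfl | hR0
      · simp
      · rw [hg.natDegree_mul' hR0] at h2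
        omega
    have h2 : (PowerSeries.trunc n B).natDegree ≤ n := by
      obtain ⟨k, rfl⟩ := Nat.exists_eq_succ_of_ne_zero (by omega : n ≠ 0)
      exact (PowerSeries.natDegree_trunc_lt B k).le
    exact natDegree_mul_le.trans ((add_le_add h1 h2).trans_eq (by ring))
  · have hR' : (((s.map fun ζ => X - C ζ).prod : ℂ[X]) : PowerSeries ℂ) * R = 1 - E := by
      rw [← Polynomial.coe_mul, ← hR, Polynomial.coe_sub, Polynomial.coe_one]
    have hdecomp : 1 - (((s.map fun ζ => X - C ζ).prod : ℂ[X]) : PowerSeries ℂ) * H *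
        ((R * PowerSeries.trunc n B : ℂ[X]) : PowerSeries ℂ)
        = E + H * (t * ((1 - E : ℂ[X]) : PowerSeries ℂ)) := by
      rw [Polynomial.coe_mul, Polynomial.coe_sub, Polynomial.coe_one, ht]
      linear_combination (-H * (PowerSeries.trunc n B : PowerSeries ℂ)) * hR' -
        (1 - (E : PowerSeries ℂ)) * hHB
    have hEn := hEK n hn E hEdeg hEc
    have hQ : sqNorm α ((1 - E : ℂ[X]) : PowerSeries ℂ) ≤ 2 * sqNorm α 1 + 2 * K := by
      have h1 := sqNorm_add_le (memSeq_polynomial α 1) (memSeq_polynomial α (-E))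
      have h2 : sqNorm α ((-E : ℂ[X]) : PowerSeries ℂ) = sqNorm α (E : PowerSeries ℂ) := by
        simp [sqNorm]
      rw [← Polynomial.coe_add, ← sub_eq_add_neg, h2, Polynomial.coe_one] at h1
      have h3 : K / weightSum α n ≤ K := div_le_self hK (one_le_weightSum α hn)
      linarith
    have hm1 := MemSeq.mul hTs (memSeq_polynomial α (1 - E))
    have hm2 := MemSeq.mul (hH.summable |α|) hm1
    have h3 : sqNorm α (H * (t * ((1 - E : ℂ[X]) : PowerSeries ℂ))) ≤ L / weightSum α n := by
      calc _ ≤ mulNorm α H ^ 2 * (mulNorm α t ^ 2 * sqNorm α ((1 - E : ℂ[X]) : PowerSeries ℂ)) :=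
            (sqNorm_mul_le (hH.summable |α|) hm1).trans (by
              gcongr; exact sqNorm_mul_le hTs (memSeq_polynomial α (1 - E)))
        _ ≤ mulNorm α H ^ 2 * (|T| / weightSum α n * (2 * sqNorm α 1 + 2 * K)) := by
            gcongr
            · exact sqNorm_nonneg _ _
            · exact hTn.trans (by gcongr; exact le_abs_self T)
        _ = _ := by rw [hL]; ring
    rw [hdecomp]
    refine (sqNorm_add_le (memSeq_polynomial α E) hm2).trans ?_
    calc _ ≤ 2 * (K / weightSum α n) + 2 * (L / weightSum α n) := by gcongr
      _ = _ := by ring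

/-- The partial sums of a series of `D_α` at a point of the unit circle are controlled by its
norm. -/
lemma norm_sum_coeff_sq_le {α : ℝ} {F : PowerSeries ℂ} (hF : MemSeq α F) {ζ : ℂ} (hζ : ‖ζ‖ = 1)
    (n : ℕ) : ‖∑ k ∈ Finset.range n, F.coeff k * ζ ^ k‖ ^ 2 ≤ weightSum α n * sqNorm α F := by
  have h1 : ‖∑ k ∈ Finset.range n, F.coeff k * ζ ^ k‖ ≤ ∑ k ∈ Finset.range n, ‖F.coeff k‖ :=
    (norm_sum_le _ _).trans_eq (by simp [hζ])
  calc _ ≤ (∑ k ∈ Finset.range n, ‖F.coeff k‖) ^ 2 := by gcongr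
    _ ≤ (∑ k ∈ Finset.range n, weight (-α) k) *
        ∑ k ∈ Finset.range n, weight α k * ‖F.coeff k‖ ^ 2 := by
        refine Finset.sum_sq_le_sum_mul_sum_of_sq_le_mul _ (fun k _ => (weight_pos _ k).le)
          (fun k _ => mul_nonneg (weight_pos _ k).le (by positivity)) fun k _ => ?_
        have h := weight_mul_weight_neg α k
        exact (by linear_combination (-‖F.coeff k‖ ^ 2) * h :
          ‖F.coeff k‖ ^ 2 = weight (-α) k * (weight α k * ‖F.coeff k‖ ^ 2)).le
    _ ≤ _ := by
        rw [← weightSum]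
        refine mul_le_mul_of_nonneg_left ?_ (weightSum_nonneg α n)
        exact hF.sum_le_tsum _ fun k _ => mul_nonneg (weight_pos _ k).le (by positivity)

/-- The lower bound for Taylor series: evaluate a partial sum of `B (1 - g H p) = B - g p` at a
zero of `g` on the unit circle. -/
lemma exists_le_sqNorm_one_sub (α : ℝ) {g : ℂ[X]} {ζ b : ℂ} (hζ : ‖ζ‖ = 1) (hg : g.eval ζ = 0)
    {H B : PowerSeries ℂ} (hH : GeomDecay H) (hB : GeomDecay B) (hHB : H * B = 1)
    (hb : HasSum (fun k => B.coeff k * ζ ^ k) b) (hb0 : b ≠ 0) :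
    ∃ c : ℝ, 0 < c ∧ ∀ (m : ℕ) (p : ℂ[X]), p.natDegree ≤ m →
      c / weightSum α (m + 1) ≤ sqNorm α (1 - (g : PowerSeries ℂ) * H * p) := by
  have hbn : ‖b‖ / 2 < ‖b‖ := half_lt_self (norm_pos_iff.2 hb0)
  obtain ⟨m₀, hm₀⟩ := eventually_atTop.1 ((hb.tendsto_sum_nat.norm).eventually_const_lt hbn)
  obtain ⟨K, hK, hKS⟩ := exists_weightSum_mul_le α (g.natDegree + m₀ + 1)
  set D := K * (mulNorm α B ^ 2 + 1) with hD
  have hD0 : 0 < D := by positivity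
  have hb2 : 0 < ‖b‖ / 2 := half_pos (norm_pos_iff.2 hb0)
  refine ⟨(‖b‖ / 2) ^ 2 / D, by positivity, fun m p hp => ?_⟩
  set a := 1 - (g : PowerSeries ℂ) * H * p with ha
  -- `N` exceeds both `m₀` and the degree of `g * p`, and stays comparable to `m + 1`
  set N := (g.natDegree + m₀ + 1) * (m + 1) with hN
  have hS := weightSum_pos α (Nat.succ_pos m)
  have hNm : m₀ ≤ N := by nlinarith
  have hNd : (g * p).natDegree < N := natDegree_mul_le.trans_lt (by nlinarith)
  have hamem : MemSeq α a := by
    have h1 : a = ((1 : ℂ[X]) : PowerSeries ℂ) + H * ((-(g * p) : ℂ[X]) : PowerSeries ℂ) := by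
      rw [ha, Polynomial.coe_one, Polynomial.coe_neg, Polynomial.coe_mul]; ring
    rw [h1]
    exact (memSeq_polynomial α 1).add
      (MemSeq.mul (hH.summable |α|) (memSeq_polynomial α (-(g * p))))
  have hBa : B * a = B - ((g * p : ℂ[X]) : PowerSeries ℂ) := by
    rw [ha, Polynomial.coe_mul]
    linear_combination (-(g : PowerSeries ℂ) * p) * hHB
  have hsum : ∑ k ∈ Finset.range N, (B * a).coeff k * ζ ^ k =
      ∑ k ∈ Finset.range N, B.coeff k * ζ ^ k := by
    have h0 : ∑ k ∈ Finset.range N, (g * p).coeff k * ζ ^ k = 0 := by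
      rw [← eval_eq_sum_range' hNd, eval_mul, hg, zero_mul]
    rw [hBa]
    simp only [map_sub, Polynomial.coeff_coe, sub_mul, Finset.sum_sub_distrib, h0, sub_zero]
  have h1 := norm_sum_coeff_sq_le (MemSeq.mul (hB.summable |α|) hamem) hζ N
  rw [hsum] at h1
  have h2 : (‖b‖ / 2) ^ 2 ≤ ‖∑ k ∈ Finset.range N, B.coeff k * ζ ^ k‖ ^ 2 := by
    have := (hm₀ N hNm).le
    gcongr
  have hpos := sqNorm_nonneg α a
  have h3 : (‖b‖ / 2) ^ 2 ≤ D * weightSum α (m + 1) * sqNorm α a := by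
    calc _ ≤ weightSum α N * sqNorm α (B * a) := h2.trans h1
      _ ≤ (K * weightSum α (m + 1)) * (mulNorm α B ^ 2 * sqNorm α a) := by
          gcongr
          · exact sqNorm_nonneg _ _
          · exact hKS _
          · exact sqNorm_mul_le (hB.summable |α|) hamem
      _ ≤ (K * weightSum α (m + 1)) * ((mulNorm α B ^ 2 + 1) * sqNorm α a) := by
          gcongr; linarith
      _ = _ := by rw [hD]; ring
  rw [div_div, div_le_iff₀ (by positivity)]
  linarith

/-! ### Distances in `D_α` -/

lemma dnorm_sq (α : ℝ) (g : ℂ → ℂ) : dnorm α g ^ 2 = sqNorm α (taylorSeries g) := by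
  have h : dnorm α g = Real.sqrt (sqNorm α (taylorSeries g)) := by
    simp only [dnorm, sqNorm, weight, coeff_taylorSeries]
  rw [h, Real.sq_sqrt (sqNorm_nonneg _ _)]

lemma dnorm_nonneg (α : ℝ) (g : ℂ → ℂ) : 0 ≤ dnorm α g := Real.sqrt_nonneg _

lemma dirichletDist_nonneg (α : ℝ) (x : ℂ → ℂ) (A : Set (ℂ → ℂ)) : 0 ≤ dist α x A :=
  Real.sInf_nonneg (by rintro _ ⟨a, _, rfl⟩; exact dnorm_nonneg _ _)

lemma dist_le_dnorm (α : ℝ) (x : ℂ → ℂ) {A : Set (ℂ → ℂ)} {a : ℂ → ℂ} (ha : a ∈ A) :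
    dist α x A ≤ dnorm α (x - a) :=
  csInf_le ⟨0, by rintro _ ⟨a, _, rfl⟩; exact dnorm_nonneg _ _⟩ ⟨a, ha, rfl⟩

lemma le_dist_sq (α : ℝ) (x : ℂ → ℂ) {A : Set (ℂ → ℂ)} (hA : A.Nonempty) {c : ℝ} (hc : 0 ≤ c)
    (h : ∀ a ∈ A, c ≤ dnorm α (x - a) ^ 2) : c ≤ dist α x A ^ 2 := by
  have h1 : Real.sqrt c ≤ dist α x A := by
    refine le_csInf (hA.image _) ?_
    rintro _ ⟨a, ha, rfl⟩
    exact Real.sqrt_le_iff.2 ⟨dnorm_nonneg _ _, h a ha⟩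
  calc c = Real.sqrt c ^ 2 := (Real.sq_sqrt hc).symm
    _ ≤ _ := by gcongr

lemma taylorSeries_one_sub_mul_eval {f : ℂ → ℂ} (hf : AnalyticAt ℂ f 0) (p : ℂ[X]) :
    taylorSeries (1 - fun z => f z * p.eval z) = 1 - taylorSeries f * (p : PowerSeries ℂ) := by
  have hp := analyticAt_eval p 0
  rw [← taylorSeries_eval p, ← taylorSeries_mul hf hp, ← taylorSeries_one,
    ← taylorSeries_sub (show AnalyticAt ℂ 1 0 from analyticAt_const) (hf.mul hp)]
  rfl

lemma phi_pos (α : ℝ) {m : ℕ} (hm : 1 ≤ m) : 0 < phi α ((m : ℝ) + 1) := by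
  have h1 : (1 : ℝ) ≤ m := by exact_mod_cast hm
  rw [phi]
  split_ifs
  · positivity
  · rw [Real.posLog_eq_log (by rw [abs_of_nonneg (by positivity)]; linarith)]
    exact Real.log_pos (by linarith)

end DirichletType

/-! ### The two-sided estimate -/

open DirichletType in
theorem theorem3p6 (α : ℝ) (hα : α ≤ 1) (f : ℂ → ℂ)
    (hf : AnalyticOnNhd ℂ f (closedBall (0 : ℂ) 1))
    (hzero : ∀ z ∈ ball (0 : ℂ) 1, f z ≠ 0) :
    (∀ m : ℕ, DirichletType.mulPol f m ⊆ DirichletType.space α) ∧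
    (∃ C : ℝ, 0 < C ∧ ∀ᶠ m : ℕ in atTop,
      DirichletType.dist α 1 (DirichletType.mulPol f m) ^ 2
        ≤ C * (DirichletType.phi α ((m : ℝ) + 1))⁻¹) ∧
    ((∃ ζ ∈ sphere (0 : ℂ) 1, f ζ = 0) →
      ∃ C' : ℝ, 0 < C' ∧ ∀ m : ℕ, 0 < DirichletType.phi α ((m : ℝ) + 1) →
        C' * (DirichletType.phi α ((m : ℝ) + 1))⁻¹
          ≤ DirichletType.dist α 1 (DirichletType.mulPol f m) ^ 2) := by
  have hmem0 : (0 : ℂ) ∈ closedBall (0 : ℂ) 1 := mem_closedBall_self zero_le_one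
  obtain ⟨s, h, hs, hh, hh0, hfac⟩ := exists_unit_circle_factorization hf hzero
  have hhi : AnalyticOnNhd ℂ h⁻¹ (closedBall 0 1) := hh.inv hh0
  have hH := geomDecay_taylorSeries hh
  have hB := geomDecay_taylorSeries hhi
  have hHB : taylorSeries h * taylorSeries h⁻¹ = 1 := by
    rw [← taylorSeries_mul (hh 0 hmem0) (hhi 0 hmem0), ← taylorSeries_one]
    refine taylorSeries_congr ?_
    filter_upwards [(hh 0 hmem0).continuousAt.eventually_ne (hh0 0 hmem0)] with z hz
    simp [hz]
  set g := (s.map fun ζ => X - C ζ).prod with hg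
  have hF : taylorSeries f = (g : PowerSeries ℂ) * taylorSeries h := by
    rw [← taylorSeries_eval g, ← taylorSeries_mul (analyticAt_eval g 0) (hh 0 hmem0)]
    congr 1
    ext z
    exact hfac z
  refine ⟨?_, ?_, ?_⟩
  · rintro m _ ⟨p, -, rfl⟩
    have han : AnalyticOnNhd ℂ (fun z => f z * p.eval z) (closedBall 0 1) :=
      fun z hz => (hf z hz).mul (analyticAt_eval p z)
    refine ⟨han.mono ball_subset_closedBall, ?_⟩
    have := (geomDecay_taylorSeries han).memSeq α
    simpa only [MemSeq, weight, coeff_taylorSeries] using this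
  · obtain ⟨K, hK, hp⟩ := exists_sqNorm_one_sub_le α s hs hH hB hHB
    obtain ⟨C₁, hC₁, hφ⟩ := exists_phi_le_mul_weightSum α hα
    obtain ⟨C₂, hC₂, hS⟩ := exists_weightSum_mul_le α (2 * (s.card + 1))
    refine ⟨K * (C₁ * C₂) + 1, by positivity, ?_⟩
    filter_upwards [eventually_ge_atTop (s.card + 1)] with m hm
    -- the approximants of index `n` have degree at most `(s.card + 1) * n`
    set n := m / (s.card + 1) with hn
    have hn1 : 1 ≤ n := (Nat.one_le_div_iff (Nat.succ_pos _)).2 hm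
    have hlt : m < (s.card + 1) * (n + 1) := Nat.lt_mul_div_succ m (Nat.succ_pos _)
    have hle : m + 1 ≤ 2 * (s.card + 1) * n := by nlinarith
    obtain ⟨p, hpdeg, hpn⟩ := hp n hn1
    have hpm : p.natDegree ≤ m := hpdeg.trans (Nat.mul_div_le m _)
    have hmem : (fun z => f z * p.eval z) ∈ mulPol f m := ⟨p, hpm, rfl⟩
    have hφ0 := phi_pos α (show 1 ≤ m by omega)
    have hSn := weightSum_pos α hn1
    have hφS : phi α ((m : ℝ) + 1) ≤ C₁ * C₂ * weightSum α n := by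
      calc _ ≤ C₁ * weightSum α (m + 1) := hφ m
        _ ≤ C₁ * (C₂ * weightSum α n) := by
            gcongr; exact (weightSum_mono α hle).trans (hS n)
        _ = _ := by ring
    calc DirichletType.dist α 1 (mulPol f m) ^ 2 ≤ dnorm α (1 - fun z => f z * p.eval z) ^ 2 :=
          pow_le_pow_left₀ (dirichletDist_nonneg _ _ _) (dist_le_dnorm α 1 hmem) 2
      _ ≤ K / weightSum α n := by
          rw [dnorm_sq, taylorSeries_one_sub_mul_eval (hf 0 hmem0), hF]; exact hpn
      _ ≤ K * (C₁ * C₂) * (phi α ((m : ℝ) + 1))⁻¹ := by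
          rw [← div_eq_mul_inv, div_le_div_iff₀ hSn hφ0]
          calc _ ≤ K * (C₁ * C₂ * weightSum α n) := by gcongr
            _ = _ := by ring
      _ ≤ _ := by gcongr; linarith
  · rintro ⟨ζ, hζ, hfζ⟩
    have hζ1 : ‖ζ‖ = 1 := mem_sphere_zero_iff_norm.1 hζ
    have hζc := sphere_subset_closedBall hζ
    have hgζ : g.eval ζ = 0 :=
      (mul_eq_zero.1 ((hfac ζ).symm.trans hfζ)).resolve_right (hh0 ζ hζc)
    have hb : HasSum (fun k => (taylorSeries h⁻¹).coeff k * ζ ^ k) (h⁻¹ ζ) := by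
      simpa only [coeff_taylorSeries] using hasSum_taylorCoeff hhi hζc
    obtain ⟨c, hc, hlow⟩ := exists_le_sqNorm_one_sub α hζ1 hgζ hH hB hHB hb
      (inv_ne_zero (hh0 ζ hζc))
    obtain ⟨C₁, hC₁, hφ⟩ := exists_weightSum_le_mul_phi α hα
    refine ⟨c / C₁, by positivity, fun m hm => ?_⟩
    have hne : (mulPol f m).Nonempty := ⟨fun z => f z * (0 : ℂ[X]).eval z, 0, by simp, rfl⟩
    refine le_dist_sq α 1 hne (by positivity) ?_
    rintro _ ⟨p, hp, rfl⟩
    rw [dnorm_sq, taylorSeries_one_sub_mul_eval (hf 0 hmem0), hF]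
    refine le_trans ?_ (hlow m p hp)
    have hSm := weightSum_pos α (Nat.succ_pos m)
    rw [← div_eq_mul_inv, div_div]
    gcongr
    exact hφ m hm

end
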